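/- **Setting.** Let $\Omega,\Sigma\subset\mathbb{R}^d$ be bounded open sets, $q\in(1,2]$, and for sets write $\Omega-\Sigma=\{x-y: x\in\Omega,\ y\in\Sigma\}$. For a bounded open set $\omega$ let $\mathcal{M}(\omega)=C_0(\omega)^*$ be the space of finite Radon measures with the dual norm $\|\cdot\|_{\mathcal M}$; a function $f\in L^p(\omega)$, $p\ge 1$, is identified with the measure $\phi\mapsto\int_\omega f\phi$. For $\mu\in\mathcal M(\omega-\Sigma)$ and $g\in L^2(\Sigma)$, let $\mu*g\in L^q(\omega)$ be the unique function such that, for all $\phi\in C_c(\omega)$ (extended by zero to $\mathbb{R}^d$), $$\int_\omega(\mu*g)\,\phi\,dx=\int_{\omega-\Sigma}\int_\Sigma\phi(x+y)\,g(x)\,dx\,d\mu(y).$$ **Generative prior.** Let $L\ge 2$ be the number of layers, $N_0=1$, $N_1,\dots,N_L\in\mathbb{N}_0$, and let $E^l\subset\{1,\dots,N_l\}\times\{1,\dots,N_{l-1}\}$ be such that every $n\in\{1,\dots,N_l\}$ occurs in some $(n,k)\in E^l$. Put $\Omega^0=\Omega$, $\Omega^l=\Omega^{l-1}-\Sigma$,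 $M=\prod_{l=1}^L\mathcal M(\Omega^l)^{N_l}$, $\Theta=\prod_{l=1}^L L^2(\Sigma)^{E^l}$ and $(\mu^l*_l\theta^l)_k=\sum_{n:(n,k)\in E^l}\mu^l_n*\theta^l_{n,k}$ for $1\le k\le N_{l-1}$. Let $Z:\Theta\to\mathbb{R}^{c}$ be bounded and linear, and for $1\le l\le L-1$ let $\mathcal J_l:\mathcal M(\Omega^l)^{N_l}\to[0,\infty]$ be such that $\mathcal J_l(\mu)<\infty$ implies $\mu\in L^2(\Omega^l)^{N_l}$. For $v\in L^q(\Omega)$ put $$\mathcal G(v)=\inf_{\mu\in M,\ \theta\in\Theta}\ \sum_{l=1}^L\sum_{n=1}^{N_l}\|\mu^l_n\|_{\mathcal M}+\sum_{l=2}^L\mathcal J_{l-1}\big(\mu^{l-1}-\mu^l*_l\theta^l\big)\quad\text{s.t. } v=\mu^1*_1\theta^1,\ \ \|\theta^l_{n,k}\|_2\le 1\ \text{for all } l,n,k,\ \ Z\theta=0,$$ with $\mathcal G(v)=\infty$ if no $(\mu,\theta)$ satisfies the constraints. **Second regularizer.** Let $\mathcal R:L^q(\Omega)\to[0,\infty]$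 be either the total variation $$\mathrm{TV}(w)=\sup\Big\{\int_\Omega w\,\mathrm{div}\,\phi\,dx:\ \phi\in C_c^\infty(\Omega;\mathbb{R}^d),\ |\phi|\le1\Big\},$$ or the restriction to $L^q(\Omega)$ of the biconjugate $J^{**}$, taken in $L^1(\Omega)$, of the functional $J:L^1(\Omega)\to[0,\infty]$ with $J(w)=\int_\Omega j(\nabla w)\,dx$ for $w\in W^{1,1}(\Omega)$ and $J(w)=\infty$ otherwise, where $j:\mathbb{R}^d\to[0,\infty)$ is coercive ($j(\xi)\to\infty$ as $|\xi|\to\infty$), convex, Lipschitz continuous and of linear growth ($j(\xi)\le C(1+|\xi|)$ for some constant $C$). **Problem.** Let $Y$ be a Banach space, $y\in Y$, $\mathcal D_y:Y\to[0,\infty]$, $A:L^q(\Omega)\to Y$, $\lambda>0$, $\nu\in(0,1)$, and consider $$(P(y))\qquad\min_{u,v\in L^q(\Omega)}\ \mathcal E_y(u,v)=\lambda\,\mathcal D_y(Au)+\tfrac{\nu}{\min(\nu,1-\nu)}\,\mathcal R(u-v)+\tfrac{1-\nu}{\min(\nu,1-\nu)}\,\mathcal G(v).$$ Assume that $\mathcal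 E_y$ is not identically $\infty$. **Proposition.** For any solution $u$ of $(P(y))$, and any $v$ such that $(u,v)$ minimizes $\mathcal E_y$, we have $u=(u-v)+v$ with $u-v\in BV(\Omega)$ (that is, $u-v\in L^1(\Omega)$ and $\mathrm{TV}(u-v)<\infty$) and $v\in C(\overline\Omega)$ (that is, $v$ has a representative that is continuous on $\overline\Omega$). -/

import Mathlib

open MeasureTheory Set Filter Topology
open scoped ENNReal Pointwise ZeroAtInfty ContDiff

noncomputable section

namespace GenPrior

/-! ### Domains and function spaces -/

/-- Bounded open subsets of `ℝ^d`. -/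
structure BoundedOpen (d : ℕ) where
  /-- the underlying set -/
  carrier : Set (EuclideanSpace ℝ (Fin d))
  isOpen : IsOpen carrier
  isBounded : Bornology.IsBounded carrier

variable {d : ℕ}

instance : CoeOut (BoundedOpen d) (Set (EuclideanSpace ℝ (Fin d))) := ⟨BoundedOpen.carrier⟩

/-- The difference set `Ω - Σ = {x - y | x ∈ Ω, y ∈ Σ}`. -/
def BoundedOpen.sub (Ω S : BoundedOpen d) : BoundedOpen d where
  carrier := Ω.carrier - S.carrier
  isOpen := Ω.isOpen.sub_right
  isBounded := Bornology.IsBounded.sub Ω.isBounded S.isBounded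

instance (Ω : BoundedOpen d) :
    IsFiniteMeasure ((volume : Measure (EuclideanSpace ℝ (Fin d))).restrict Ω.carrier) :=
  ⟨by simpa using Ω.isBounded.measure_lt_top⟩

/-- The Lebesgue space `L^q(Ω)` of real functions (classes modulo null sets). -/
abbrev LpOn (q : ℝ≥0∞) (Ω : BoundedOpen d) : Type :=
  Lp ℝ q ((volume : Measure (EuclideanSpace ℝ (Fin d))).restrict Ω.carrier)

/-- The inclusion `L^q(Ω) ⊆ L^p(Ω)` for `p ≤ q` (`Ω` has finite measure). -/
def LpOn.incl {Ω : BoundedOpen d} {p q : ℝ≥0∞} (h : p ≤ q) (f : LpOn q Ω) : LpOn p Ω :=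
  ⟨f.1, Lp.antitone h f.2⟩

/-- The space `M(Ω)` of finite (signed) Radon measures: the dual of `C_0(Ω)`, with the dual norm
(which is the total variation norm). -/
abbrev Radon (Ω : BoundedOpen d) : Type := StrongDual ℝ C₀(Ω.carrier, ℝ)

/-- Lebesgue measure on `Ω`, as a measure on the subtype. -/
abbrev vol (Ω : BoundedOpen d) : Measure Ω.carrier :=
  (volume : Measure (EuclideanSpace ℝ (Fin d))).comap Subtype.val

theorem LpOn.integrable_comap {Ω : BoundedOpen d} {q : ℝ≥0∞} [hq : Fact (1 ≤ q)] (f : LpOn q Ω) :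
    Integrable (fun x : Ω.carrier => f x.1) (vol Ω) := by
  have h1 : Integrable f ((volume : Measure (EuclideanSpace ℝ (Fin d))).restrict Ω.carrier) :=
    (Lp.memLp f).integrable hq.out
  have hme : MeasurableEmbedding (Subtype.val : Ω.carrier → EuclideanSpace ℝ (Fin d)) :=
    MeasurableEmbedding.subtype_coe Ω.isOpen.measurableSet
  have h2 : Integrable f ((vol Ω).map Subtype.val) ↔
      Integrable ((f : EuclideanSpace ℝ (Fin d) → ℝ) ∘ Subtype.val) (vol Ω) :=
    hme.integrable_map_iff
  rw [map_comap_subtype_coe Ω.isOpen.measurableSet] at h2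
  exact h2.1 h1

theorem LpOn.integrable_mul {Ω : BoundedOpen d} {q : ℝ≥0∞} [hq : Fact (1 ≤ q)] (f : LpOn q Ω)
    (φ : C₀(Ω.carrier, ℝ)) : Integrable (fun x : Ω.carrier => f x.1 * φ x) (vol Ω) :=
  (LpOn.integrable_comap f).mul_bdd (c := ‖φ‖) φ.continuous.aestronglyMeasurable
    (ae_of_all _ fun x => φ.toBCF.norm_coe_le_norm x)

/-- A function `f ∈ L^q(Ω)`, seen as the measure `φ ↦ ∫_Ω f φ`. -/
def LpOn.toRadon {Ω : BoundedOpen d} {q : ℝ≥0∞} [Fact (1 ≤ q)] (f : LpOn q Ω) : Radon Ω :=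
  LinearMap.mkContinuous
    { toFun := fun φ : C₀(Ω.carrier, ℝ) => ∫ x : Ω.carrier, f x.1 * φ x ∂(vol Ω)
      map_add' := fun φ ψ => by
        simp only [ZeroAtInftyContinuousMap.add_apply, mul_add]
        exact integral_add (LpOn.integrable_mul f φ) (LpOn.integrable_mul f ψ)
      map_smul' := fun c φ => by
        simp only [ZeroAtInftyContinuousMap.smul_apply, smul_eq_mul, RingHom.id_apply]
        rw [← integral_const_mul]
        congr 1; ext x; ring }
    (∫ x : Ω.carrier, ‖f x.1‖ ∂(vol Ω)) (fun φ => by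
      refine (norm_integral_le_integral_norm _).trans ?_
      rw [← integral_mul_const]
      refine integral_mono (LpOn.integrable_mul f φ).norm ((LpOn.integrable_comap f).norm.mul_const _) ?_
      intro x
      simp only [norm_mul]
      exact mul_le_mul_of_nonneg_left (φ.toBCF.norm_coe_le_norm x) (norm_nonneg _))

/-! ### Convolution of a measure and an `L^2` function -/

/-- The space `C_c(Ω)`; its elements are represented by their extensions by zero to `ℝ^d`. -/
def Cc (Ω : BoundedOpen d) : Submodule ℝ (EuclideanSpace ℝ (Fin d) → ℝ) where
  carrier := {φ | Continuous φ ∧ HasCompactSupport φ ∧ tsupport φ ⊆ Ω.carrier}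
  zero_mem' := ⟨continuous_zero, HasCompactSupport.zero, by simp [tsupport]⟩
  add_mem' := fun {φ ψ} hφ hψ => ⟨hφ.1.add hψ.1, hφ.2.1.add hψ.2.1,
    (tsupport_add φ ψ).trans (union_subset hφ.2.2 hψ.2.2)⟩
  smul_mem' := fun c φ hφ => ⟨hφ.1.const_smul c, hφ.2.1.smul_left,
    (tsupport_smul_subset_right (fun _ => c) φ).trans hφ.2.2⟩

theorem Cc.exists_bound {Ω : BoundedOpen d} (φ : Cc Ω) : ∃ C, ∀ x, ‖φ.1 x‖ ≤ C :=
  φ.2.1.bounded_above_of_compact_support φ.2.2.1 |>.imp fun _ h => h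

theorem Cc.eq_zero {Ω : BoundedOpen d} (φ : Cc Ω) {x : EuclideanSpace ℝ (Fin d)}
    (hx : x ∉ Ω.carrier) : φ.1 x = 0 :=
  image_eq_zero_of_notMem_tsupport fun h => hx (φ.2.2.2 h)

theorem continuous_pairing {Ω S : BoundedOpen d} (φ : Cc Ω) (g : LpOn 2 S) :
    Continuous fun y => ∫ x in S.carrier, φ.1 (x + y) * g x := by
  obtain ⟨C, hC⟩ := Cc.exists_bound φ
  have hφ : Continuous φ.1 := φ.2.1
  have hg : Integrable g (volume.restrict S.carrier) := (Lp.memLp g).integrable (by norm_num)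
  refine continuous_of_dominated (bound := fun x => C * ‖g x‖) ?_ ?_ (hg.norm.const_mul C) ?_
  · intro y
    exact (hφ.comp (continuous_id.add continuous_const)).aestronglyMeasurable.mul
      hg.aestronglyMeasurable
  · intro y
    refine ae_of_all _ fun x => ?_
    rw [norm_mul]
    exact mul_le_mul_of_nonneg_right (hC _) (norm_nonneg _)
  · refine ae_of_all _ fun x => ?_
    exact (hφ.comp (continuous_const.add continuous_id)).mul continuous_const

theorem pairing_eq_zero {Ω S : BoundedOpen d} (φ : Cc Ω) (g : LpOn 2 S)
    {y : EuclideanSpace ℝ (Fin d)} (hy : y ∉ (Ω.sub S).carrier) :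
    ∫ x in S.carrier, φ.1 (x + y) * g x = 0 := by
  rw [setIntegral_congr_fun (g := fun _ => (0 : ℝ)) S.isOpen.measurableSet]
  · simp
  · intro x hx
    have : x + y ∉ Ω.carrier := fun h => hy ⟨x + y, h, x, hx, by simp⟩
    simp [Cc.eq_zero φ this]

/-- The inner integral `y ↦ ∫_Σ φ(x + y) g(x) dx` as an element of `C_0(Ω - Σ)`. -/
def pairing {Ω S : BoundedOpen d} (φ : Cc Ω) (g : LpOn 2 S) : C₀((Ω.sub S).carrier, ℝ) where
  toFun y := ∫ x in S.carrier, φ.1 (x + y.1) * g x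
  continuous_toFun := (continuous_pairing φ g).comp continuous_subtype_val
  zero_at_infty' := by
    rw [Metric.tendsto_nhds]
    intro ε hε
    set K : Set (EuclideanSpace ℝ (Fin d)) :=
      {y | ε ≤ |∫ x in S.carrier, φ.1 (x + y) * g x|} with hK
    have hsub : K ⊆ (Ω.sub S).carrier := by
      intro y hy
      by_contra h
      rw [hK, mem_ofPred_eq, pairing_eq_zero φ g h, abs_zero] at hy
      linarith
    have hcl : IsClosed K := isClosed_le continuous_const (continuous_pairing φ g).abs
    have hcomp : IsCompact K :=
      Metric.isCompact_of_isClosed_isBounded hcl ((Ω.sub S).isBounded.subset hsub)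
    have hpre : IsCompact (Subtype.val ⁻¹' K : Set (Ω.sub S).carrier) := by
      rw [Subtype.isCompact_iff, Subtype.image_preimage_coe, inter_eq_right.2 hsub]
      exact hcomp
    filter_upwards [hpre.compl_mem_cocompact] with y hy
    rw [mem_compl_iff, mem_preimage, hK, mem_ofPred_eq, not_le] at hy
    simpa [Real.dist_eq] using hy

/-- `w ∈ L^q(Ω)` satisfies the defining property of `μ * g`, for `μ ∈ M(Ω - Σ)`, `g ∈ L^2(Σ)`:
`∫_Ω w φ = ∫_{Ω - Σ} ∫_Σ φ(x + y) g(x) dx dμ(y)` for all `φ ∈ C_c(Ω)`. -/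
def IsConv {Ω S : BoundedOpen d} {q : ℝ≥0∞} (μ : Radon (Ω.sub S)) (g : LpOn 2 S)
    (w : LpOn q Ω) : Prop :=
  ∀ φ : Cc Ω, ∫ x in Ω.carrier, w x * φ.1 x = μ (pairing φ g)

theorem Cc.memLp {Ω : BoundedOpen d} (φ : Cc Ω) :
    MemLp φ.1 2 ((volume : Measure (EuclideanSpace ℝ (Fin d))).restrict Ω.carrier) :=
  φ.2.1.memLp_of_hasCompactSupport φ.2.2.1

/-- The class in `L^2(Ω)` of an element of `C_c(Ω)`. -/
def Cc.toL2 {Ω : BoundedOpen d} : Cc Ω →ₗ[ℝ] LpOn 2 Ω where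
  toFun φ := (Cc.memLp φ).toLp φ.1
  map_add' _ _ := rfl
  map_smul' _ _ := rfl

theorem norm_pairing_le {Ω S : BoundedOpen d} (φ : Cc Ω) (g : LpOn 2 S) :
    ‖pairing φ g‖ ≤ ‖Cc.toL2 φ‖ * ‖g‖ := by
  refine (BoundedContinuousFunction.norm_le (f := (pairing φ g).toBCF) (by positivity)).2 ?_
  intro y
  have hL : ∀ μ : Measure (EuclideanSpace ℝ (Fin d)), [IsFiniteMeasureOnCompacts μ] →
      MemLp φ.1 2 μ := fun μ _ => φ.2.1.memLp_of_hasCompactSupport φ.2.2.1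
  have hmp : MeasurePreserving (fun x : EuclideanSpace ℝ (Fin d) => x + y.1) volume volume :=
    measurePreserving_add_right volume y.1
  have hy : MemLp (fun x => φ.1 (x + y.1)) 2
      ((volume : Measure (EuclideanSpace ℝ (Fin d))).restrict S.carrier) :=
    ((hL volume).comp_measurePreserving hmp).restrict _
  have h1 : (pairing φ g) y = inner ℝ (hy.toLp _) g := by
    rw [L2.inner_def]
    refine integral_congr_ae ?_
    filter_upwards [hy.coeFn_toLp] with x hx
    rw [hx]
    simp [mul_comm]
  have h2 : ‖hy.toLp _‖ ≤ ‖Cc.toL2 φ‖ := by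
    change ‖hy.toLp _‖ ≤ ‖(Cc.memLp φ).toLp φ.1‖
    rw [Lp.norm_toLp, Lp.norm_toLp]
    refine ENNReal.toReal_mono (Cc.memLp φ).eLpNorm_ne_top ?_
    calc _ ≤ eLpNorm (fun x => φ.1 (x + y.1)) 2 volume :=
          eLpNorm_mono_measure _ Measure.restrict_le_self
      _ = eLpNorm φ.1 2 volume :=
          eLpNorm_comp_measurePreserving (hL volume).aestronglyMeasurable hmp
      _ = _ := by
          rw [eLpNorm_restrict_eq_of_support_subset]
          exact (subset_tsupport _).trans φ.2.2.2
  change ‖(pairing φ g) y‖ ≤ _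
  rw [h1]
  exact (norm_inner_le_norm _ _).trans (by gcongr)

theorem integrable_pairing {Ω S : BoundedOpen d} (φ : Cc Ω) (g : LpOn 2 S)
    (y : EuclideanSpace ℝ (Fin d)) :
    Integrable (fun x => φ.1 (x + y) * g x) (volume.restrict S.carrier) := by
  obtain ⟨C, hC⟩ := Cc.exists_bound φ
  have hφ : Continuous φ.1 := φ.2.1
  exact ((Lp.memLp g).integrable (by norm_num)).bdd_mul (c := C)
    (hφ.comp (continuous_id.add continuous_const)).aestronglyMeasurable
    (ae_of_all _ fun x => hC _)

theorem pairing_add {Ω S : BoundedOpen d} (φ ψ : Cc Ω) (g : LpOn 2 S) :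
    pairing (φ + ψ) g = pairing φ g + pairing ψ g := by
  ext y
  change ∫ x in S.carrier, (φ.1 (x + y.1) + ψ.1 (x + y.1)) * g x = _
  simp only [add_mul]
  exact integral_add (integrable_pairing φ g y.1) (integrable_pairing ψ g y.1)

theorem pairing_smul {Ω S : BoundedOpen d} (c : ℝ) (φ : Cc Ω) (g : LpOn 2 S) :
    pairing (c • φ) g = c • pairing φ g := by
  ext y
  change ∫ x in S.carrier, (c * φ.1 (x + y.1)) * g x = _
  simp only [mul_assoc]
  exact integral_const_mul _ _

theorem exists_isConv {Ω S : BoundedOpen d} (μ : Radon (Ω.sub S)) (g : LpOn 2 S) :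
    ∃ w : LpOn 2 Ω, IsConv μ g w := by
  let ℓ : Cc Ω →ₗ[ℝ] ℝ :=
    { toFun := fun φ => μ (pairing φ g)
      map_add' := fun φ ψ => by rw [pairing_add, map_add]
      map_smul' := fun c φ => by rw [pairing_smul, map_smul]; rfl }
  have hℓ : ∀ φ, ‖ℓ φ‖ ≤ (‖μ‖ * ‖g‖) * ‖Cc.toL2 φ‖ := fun φ =>
    (μ.le_opNorm _).trans (by
      rw [mul_assoc, mul_comm ‖g‖]
      exact mul_le_mul_of_nonneg_left (norm_pairing_le φ g) (norm_nonneg _))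
  have hker : LinearMap.ker (Cc.toL2 (Ω := Ω)) ≤ LinearMap.ker ℓ := fun φ hφ => by
    have := hℓ φ
    rw [LinearMap.mem_ker.1 hφ, norm_zero, mul_zero] at this
    exact norm_le_zero_iff.1 this
  let ℓ' : LinearMap.range (Cc.toL2 (Ω := Ω)) →ₗ[ℝ] ℝ :=
    ((LinearMap.ker (Cc.toL2 (Ω := Ω))).liftQ ℓ hker).comp
      (Cc.toL2 (Ω := Ω)).quotKerEquivRange.symm.toLinearMap
  have hℓ' : ∀ φ : Cc Ω, ℓ' ⟨Cc.toL2 φ, LinearMap.mem_range_self _ φ⟩ = ℓ φ := fun φ => by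
    simp only [ℓ', LinearMap.comp_apply, LinearEquiv.coe_coe]
    rw [LinearMap.quotKerEquivRange_symm_apply_image, Submodule.mkQ_apply, Submodule.liftQ_apply]
  let f : StrongDual ℝ (LinearMap.range (Cc.toL2 (Ω := Ω))) :=
    ℓ'.mkContinuous (‖μ‖ * ‖g‖) (by
      rintro ⟨_, φ, rfl⟩
      rw [hℓ']
      exact hℓ φ)
  obtain ⟨F, hF, -⟩ := exists_extension_norm_eq _ f
  refine ⟨(InnerProductSpace.toDual ℝ (LpOn 2 Ω)).symm F, fun φ => ?_⟩
  have h1 : F (Cc.toL2 φ) = μ (pairing φ g) :=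
    (hF ⟨Cc.toL2 φ, LinearMap.mem_range_self _ φ⟩).trans (hℓ' φ)
  rw [← h1, ← InnerProductSpace.toDual_symm_apply, L2.inner_def]
  refine integral_congr_ae ?_
  have h2 : (Cc.toL2 φ : EuclideanSpace ℝ (Fin d) → ℝ)
      =ᵐ[volume.restrict Ω.carrier] φ.1 := (Cc.memLp φ).coeFn_toLp
  filter_upwards [h2] with x hx
  rw [hx]
  simp [mul_comm]

/-- Existence and uniqueness of the convolution. -/
theorem existsUnique_isConv {Ω S : BoundedOpen d} {q : ℝ≥0∞} [hq1 : Fact (1 ≤ q)] (hq : q ≤ 2)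
    (μ : Radon (Ω.sub S)) (g : LpOn 2 S) : ∃! w : LpOn q Ω, IsConv μ g w := by
  obtain ⟨w, hw⟩ := exists_isConv μ g
  refine ⟨LpOn.incl hq w, hw, fun w' hw' => ?_⟩
  have hint : ∀ {p : ℝ≥0∞} [Fact (1 ≤ p)] (f : LpOn p Ω),
      IntegrableOn f Ω.carrier volume := fun {p} hp f => (Lp.memLp f).integrable hp.out
  have i1 := hint w'
  have i2 := hint w
  refine Lp.ext ?_
  change w' =ᵐ[volume.restrict Ω.carrier] w
  have key := Ω.isOpen.ae_eq_zero_of_integral_contDiff_smul_eq_zero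
    (f := fun x => w' x - w x) (μ := volume) (i1.sub i2).locallyIntegrableOn (by
      intro φ h1 h2 h3
      let φ' : Cc Ω := ⟨φ, h1.continuous, h2, h3⟩
      have e := (hw' φ').trans (hw φ').symm
      obtain ⟨C, hC⟩ := Cc.exists_bound φ'
      have j : ∀ {f : EuclideanSpace ℝ (Fin d) → ℝ}, IntegrableOn f Ω.carrier volume →
          IntegrableOn (fun x => f x * φ x) Ω.carrier volume := fun h =>
        Integrable.mul_bdd (c := C) h h1.continuous.aestronglyMeasurable (ae_of_all _ hC)
      rw [← setIntegral_eq_integral_of_forall_compl_eq_zero (s := Ω.carrier)]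
      · have : ∀ x, φ x • (w' x - w x) = w' x * φ x - w x * φ x := fun x => by
          simp only [smul_eq_mul]; ring
        simp only [this]
        rw [integral_sub (j i1) (j i2), sub_eq_zero]
        exact e
      · intro x hx
        have : φ x = 0 := Cc.eq_zero φ' hx
        simp [this])
  rw [Filter.EventuallyEq, ae_restrict_iff' Ω.isOpen.measurableSet]
  filter_upwards [key] with x hx hxΩ
  exact sub_eq_zero.1 (hx hxΩ)

/-- The convolution `μ * g ∈ L^q(Ω)` of `μ ∈ M(Ω - Σ)` and `g ∈ L^2(Σ)`, for `1 ≤ q ≤ 2`. -/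
def conv (q : ℝ≥0∞) {Ω S : BoundedOpen d} (μ : Radon (Ω.sub S)) (g : LpOn 2 S) : LpOn q Ω :=
  Classical.epsilon fun w : LpOn q Ω => IsConv μ g w

theorem isConv_conv {Ω S : BoundedOpen d} {q : ℝ≥0∞} [Fact (1 ≤ q)] (hq : q ≤ 2)
    (μ : Radon (Ω.sub S)) (g : LpOn 2 S) : IsConv μ g (conv q μ g) :=
  Classical.epsilon_spec (existsUnique_isConv hq μ g).exists

/-! ### The generative prior -/

/-- The domains `Ω^0 = Ω`, `Ω^{l+1} = Ω^l - Σ`. -/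
def layerDomain (Ω S : BoundedOpen d) : ℕ → BoundedOpen d
  | 0 => Ω
  | l + 1 => (layerDomain Ω S l).sub S

/-- The architecture of the network: the number `L ≥ 1` of layers, the numbers `N_l` of latent
variables (`N_0 = 1`; only `N_0, …, N_L` matter) and the sets `E^1, …, E^L` of connections
(`edges l` is `E^{l+1}`), such that each latent variable of layer `l + 1` is connected to some
latent variable of layer `l`. -/
structure Network where
  /-- the number of layers -/
  L : ℕ
  L_pos : 0 < L
  /-- the number of latent variables in each layer -/
  N : ℕ → ℕ
  N_zero : N 0 = 1
  /-- the connections between layers -/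
  edges : (l : Fin L) → Finset (Fin (N (l + 1)) × Fin (N l))
  connected : ∀ (l : Fin L) (n : Fin (N (l + 1))), ∃ k, (n, k) ∈ edges l

/-- `M^l = M(Ω^l)^{N_l}`. -/
abbrev LayerVar (net : Network) (Ω S : BoundedOpen d) (l : ℕ) : Type :=
  Fin (net.N l) → Radon (layerDomain Ω S l)

/-- `M = M^1 × ⋯ × M^L`; the entry with index `l : Fin L` is `μ^{l+1}`. -/
abbrev Latent (net : Network) (Ω S : BoundedOpen d) : Type :=
  (l : Fin net.L) → LayerVar net Ω S (l + 1)

/-- `Θ = Θ^1 × ⋯ × Θ^L` with `Θ^l = L^2(Σ)^{E^l}`; the entry with index `l : Fin L` is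
`θ^{l+1}`. -/
abbrev Kernels (net : Network) (S : BoundedOpen d) : Type :=
  (l : Fin net.L) → ↥(net.edges l) → LpOn 2 S

/-- The `k`-th component of `μ^{l+1} *_{l+1} θ^{l+1}`, the sum of `μ_n * θ_{n,k}` over all `n` with
`(n, k) ∈ E^{l+1}`, as a function in `L^q(Ω^l)`. -/
def layerConv (q : ℝ≥0∞) {net : Network} {Ω S : BoundedOpen d} (l : Fin net.L)
    (μ : LayerVar net Ω S (l + 1)) (θ : ↥(net.edges l) → LpOn 2 S) (k : Fin (net.N l)) :
    LpOn q (layerDomain Ω S l) :=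
  ∑ e : ↥(net.edges l), if e.1.2 = k then
    conv q (Ω := layerDomain Ω S l) (S := S) (μ e.1.1) (θ e) else 0

/-- The objective `‖μ‖_M + ∑_{l=2}^L J_{l-1}(μ^{l-1} - μ^l *_l θ^l)`. -/
def genCost (q : ℝ≥0∞) [Fact (1 ≤ q)] {net : Network} {Ω S : BoundedOpen d}
    (J : (l : ℕ) → LayerVar net Ω S l → ℝ≥0∞) (μ : Latent net Ω S) (θ : Kernels net S) : ℝ≥0∞ :=
  (∑ l, ∑ n, ‖μ l n‖ₑ) +
    ∑ l : Fin net.L, if h : (l : ℕ) + 1 < net.L then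
      J (l + 1) fun k => μ l k -
        (layerConv q (⟨l + 1, h⟩ : Fin net.L) (μ ⟨l + 1, h⟩) (θ ⟨l + 1, h⟩) k).toRadon
    else 0

/-- The feasible set: `v = μ^1 *_1 θ^1`, all kernels have `L^2` norm at most one, `Z θ = 0`. -/
def Feasible {q : ℝ≥0∞} {net : Network} {Ω S : BoundedOpen d} {c : ℕ}
    (Z : Kernels net S →L[ℝ] EuclideanSpace ℝ (Fin c)) (v : LpOn q Ω)
    (μ : Latent net Ω S) (θ : Kernels net S) : Prop :=
  v = layerConv q (Ω := Ω) ⟨0, net.L_pos⟩ (μ ⟨0, net.L_pos⟩) (θ ⟨0, net.L_pos⟩)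
      ⟨0, by simp [net.N_zero]⟩ ∧
    (∀ l e, ‖θ l e‖ ≤ 1) ∧ Z θ = 0

/-- The generative prior `G(v)` (the infimum over the empty set is `∞`). -/
def genPrior {q : ℝ≥0∞} [Fact (1 ≤ q)] {net : Network} {Ω S : BoundedOpen d} {c : ℕ}
    (J : (l : ℕ) → LayerVar net Ω S l → ℝ≥0∞)
    (Z : Kernels net S →L[ℝ] EuclideanSpace ℝ (Fin c)) (v : LpOn q Ω) : ℝ≥0∞ :=
  ⨅ (μ : Latent net Ω S) (θ : Kernels net S) (_ : Feasible Z v μ θ), genCost q J μ θ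

/-! ### Total variation, `BV`, and functionals of linear growth -/

/-- The divergence of a vector field on `ℝ^d`. -/
def divergence (φ : EuclideanSpace ℝ (Fin d) → EuclideanSpace ℝ (Fin d))
    (x : EuclideanSpace ℝ (Fin d)) : ℝ :=
  ∑ i, fderiv ℝ φ x (EuclideanSpace.single i 1) i

/-- Vector fields in `C_c^∞(Ω; ℝ^d)` of (Euclidean) norm at most one everywhere. -/
def IsTVField (Ω : BoundedOpen d)
    (φ : EuclideanSpace ℝ (Fin d) → EuclideanSpace ℝ (Fin d)) : Prop :=
  ContDiff ℝ ∞ φ ∧ HasCompactSupport φ ∧ tsupport φ ⊆ Ω.carrier ∧ ∀ x, ‖φ x‖ ≤ 1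

/-- The total variation `TV(f) = sup ∫_Ω f div φ` of a function `f ∈ L^1(Ω)`. -/
def TV (Ω : BoundedOpen d) (f : EuclideanSpace ℝ (Fin d) → ℝ) : ℝ≥0∞ :=
  ⨆ (φ : EuclideanSpace ℝ (Fin d) → EuclideanSpace ℝ (Fin d)) (_ : IsTVField Ω φ),
    ENNReal.ofReal (∫ x in Ω.carrier, f x * divergence φ x)

/-- `f ∈ BV(Ω)`: `f ∈ L^1(Ω)` has finite total variation. -/
def MemBV (Ω : BoundedOpen d) (f : EuclideanSpace ℝ (Fin d) → ℝ) : Prop :=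
  IntegrableOn f Ω.carrier ∧ TV Ω f < ⊤

/-- `g ∈ L^1(Ω; ℝ^d)` is the weak gradient of `f` on `Ω`. -/
def IsWeakGradient (Ω : BoundedOpen d) (f : EuclideanSpace ℝ (Fin d) → ℝ)
    (g : EuclideanSpace ℝ (Fin d) → EuclideanSpace ℝ (Fin d)) : Prop :=
  IntegrableOn g Ω.carrier ∧
    ∀ φ : EuclideanSpace ℝ (Fin d) → ℝ, ContDiff ℝ ∞ φ → HasCompactSupport φ →
      tsupport φ ⊆ Ω.carrier → ∀ i,
        ∫ x in Ω.carrier, f x * fderiv ℝ φ x (EuclideanSpace.single i 1) =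
          -∫ x in Ω.carrier, g x i * φ x

open Classical in
/-- The functional `J(w) = ∫_Ω j(∇w)` if `w ∈ W^{1,1}(Ω)`, and `J(w) = ∞` for all other
`w ∈ L^1(Ω)`. -/
def gradEnergy (Ω : BoundedOpen d) (j : EuclideanSpace ℝ (Fin d) → ℝ) (w : LpOn 1 Ω) : ℝ≥0∞ :=
  if h : ∃ g, IsWeakGradient Ω w g then
    ∫⁻ x in Ω.carrier, ENNReal.ofReal (j (h.choose x))
  else ⊤

/-- The convex conjugate `F*(p) = sup_x p(x) - F(x)` on the dual of a normed space. -/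
def conjugate {X : Type*} [NormedAddCommGroup X] [NormedSpace ℝ X] (F : X → EReal)
    (p : StrongDual ℝ X) : EReal :=
  ⨆ x, ((p x : ℝ) : EReal) - F x

/-- The biconjugate `F**(x) = sup_p p(x) - F*(p)`. -/
def biconjugate {X : Type*} [NormedAddCommGroup X] [NormedSpace ℝ X] (F : X → EReal)
    (x : X) : EReal :=
  ⨆ p : StrongDual ℝ X, ((p x : ℝ) : EReal) - conjugate F p

theorem biconjugate_nonneg {X : Type*} [NormedAddCommGroup X] [NormedSpace ℝ X] {F : X → EReal}
    (hF : ∀ x, 0 ≤ F x) (x : X) : 0 ≤ biconjugate F x := by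
  have h : conjugate F 0 ≤ 0 := iSup_le fun y => by
    simpa using hF y
  refine le_trans ?_ (le_iSup _ (0 : StrongDual ℝ X))
  simpa using h

/-- The functional `J**` on `L^q(Ω) ⊆ L^1(Ω)`, where the biconjugate (which is nonnegative) is taken
in `L^1(Ω)`. -/
def linearGrowthReg {q : ℝ≥0∞} [hq : Fact (1 ≤ q)] (Ω : BoundedOpen d)
    (j : EuclideanSpace ℝ (Fin d) → ℝ) (w : LpOn q Ω) : ℝ≥0∞ :=
  (biconjugate (fun w' : LpOn 1 Ω => (gradEnergy Ω j w' : EReal))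
    (LpOn.incl hq.out w)).toENNReal

/-- `j : ℝ^d → [0, ∞)` is coercive, convex, Lipschitz continuous and of linear growth. -/
structure IsLinearGrowthIntegrand (j : EuclideanSpace ℝ (Fin d) → ℝ) : Prop where
  nonneg : ∀ ξ, 0 ≤ j ξ
  coercive : Tendsto j (Bornology.cobounded _) atTop
  convex : ConvexOn ℝ univ j
  lipschitz : ∃ K, LipschitzWith K j
  linear_growth : ∃ C, ∀ ξ, j ξ ≤ C * (1 + ‖ξ‖)

/-! ### The variational problem -/

/-- The weight `ν / min(ν, 1 - ν)`. -/
def weightR (ν : ℝ) : ℝ := ν / min ν (1 - ν)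

/-- The weight `(1 - ν) / min(ν, 1 - ν)`. -/
def weightG (ν : ℝ) : ℝ := (1 - ν) / min ν (1 - ν)

/-- `E_y(u, v) = λ D_y(A u) + s_R(ν) R(u - v) + s_G(ν) G(v)`. -/
def energy {q : ℝ≥0∞} {Ω : BoundedOpen d} {Y : Type*} (lam ν : ℝ) (D : Y → ℝ≥0∞)
    (A : LpOn q Ω → Y) (R G : LpOn q Ω → ℝ≥0∞) (u v : LpOn q Ω) : ℝ≥0∞ :=
  ENNReal.ofReal lam * D (A u) + ENNReal.ofReal (weightR ν) * R (u - v) +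
    ENNReal.ofReal (weightG ν) * G v

/-- `v ∈ C(Ω̄)`: the class `v` has a representative that is continuous on the closure of `Ω`. -/
def MemCClosure {q : ℝ≥0∞} {Ω : BoundedOpen d} (v : LpOn q Ω) : Prop :=
  ∃ f : EuclideanSpace ℝ (Fin d) → ℝ,
    ContinuousOn f (closure Ω.carrier) ∧ v =ᵐ[volume.restrict Ω.carrier] f

end GenPrior

end

noncomputable section

namespace GenPrior

variable {d : ℕ}

/-! ### Continuity of the convolution of square integrable functions -/

/-! The energy is finite at a minimizer because it is finite somewhere. Both weights are positive,
so `R (u - v)` and the generative prior of `v` are finite, and the two regularity claims follow from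
these separately.

Continuity of `v`: finite prior gives a feasible pair of finite cost, so the penalty on μ¹ - μ² * θ²
is finite and this difference lies in L². The convolution μ² * θ² is itself in L², by Cauchy–Schwarz
and duality (`exists_isConv`). Hence μ¹ is in L², and `v` is a finite sum of convolutions of two L²
functions. These are continuous on the whole space, since translation is continuous in L²
(`continuous_integral_mul_comp_sub`, `memCClosure_conv_toRadon`).

Bounded variation of `u - v`: for `R = TV` nothing is left to show. For J**, convexity and
coercivity give j(ξ) ≥ |ξ|/r - 1. For an admissible field φ, the functional w ↦ r⁻¹ ∫ w div φ then
has conjugate at most |Ω| (`conjugate_gradEnergy_le`). Inserting it in the supremum defining J**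
yields TV(w) ≤ r (J**(w) + |Ω|). -/

theorem continuous_integral_mul_comp_sub {H G : EuclideanSpace ℝ (Fin d) → ℝ}
    (hH : MemLp H 2 volume) (hG : MemLp G 2 volume) :
    Continuous fun z => ∫ y, H y * G (z - y) := by
  have hG' : MemLp (fun x => G (-x)) 2 volume :=
    hG.comp_measurePreserving (Measure.measurePreserving_neg volume)
  -- The integral is the L² inner product of `H` with a translate of the reflection of `G`.
  -- Translations act continuously on Lᵖ only for finite exponents, hence this instance.
  have : Fact ((2 : ℝ≥0∞) ≠ ⊤) := ⟨by norm_num⟩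
  have hc : Continuous fun z : EuclideanSpace ℝ (Fin d) =>
      inner ℝ (hH.toLp H) (DomAddAct.mk (-z) +ᵥ hG'.toLp _) := by
    have h1 : Continuous fun z : EuclideanSpace ℝ (Fin d) => DomAddAct.mk (-z) :=
      DomAddAct.continuous_mk.comp continuous_neg
    have h2 : Continuous fun z : EuclideanSpace ℝ (Fin d) => DomAddAct.mk (-z) +ᵥ hG'.toLp _ :=
      h1.vadd continuous_const
    exact continuous_const.inner h2
  refine hc.congr fun z => ?_
  rw [L2.inner_def, DomAddAct.mk_vadd_toLp]
  refine integral_congr_ae ?_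
  have hz : MemLp (fun x => G (-(-z +ᵥ x))) 2 volume :=
    hG'.comp_measurePreserving (measurePreserving_vadd (-z) volume)
  filter_upwards [hH.coeFn_toLp, hz.coeFn_toLp] with x h1 h2
  rw [h1]
  erw [h2]
  simp [mul_comm, sub_eq_neg_add, add_comm]

theorem memLp_indicator {Ω : BoundedOpen d} {q : ℝ≥0∞} (f : LpOn q Ω) :
    MemLp (Ω.carrier.indicator f) q volume :=
  (memLp_indicator_iff_restrict Ω.isOpen.measurableSet).2 (Lp.memLp f)

theorem integrable_indicator {Ω : BoundedOpen d} {q : ℝ≥0∞} [hq : Fact (1 ≤ q)] (f : LpOn q Ω) :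
    Integrable (Ω.carrier.indicator f) volume :=
  (integrable_indicator_iff Ω.isOpen.measurableSet).2 ((Lp.memLp f).integrable hq.out)

/-- The pointwise convolution `z ↦ ∫ h(y) g(z - y) dy` of functions extended by zero. -/
def convFun {Ω S : BoundedOpen d} (h : LpOn 2 Ω) (g : LpOn 2 S)
    (z : EuclideanSpace ℝ (Fin d)) : ℝ :=
  ∫ y, Ω.carrier.indicator h y * S.carrier.indicator g (z - y)

theorem continuous_convFun {Ω S : BoundedOpen d} (h : LpOn 2 Ω) (g : LpOn 2 S) :
    Continuous (convFun h g) :=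
  continuous_integral_mul_comp_sub (memLp_indicator h) (memLp_indicator g)

theorem toRadon_apply {Ω : BoundedOpen d} {q : ℝ≥0∞} [Fact (1 ≤ q)] (f : LpOn q Ω)
    (φ : C₀(Ω.carrier, ℝ)) : f.toRadon φ = ∫ x : Ω.carrier, f x.1 * φ x ∂(vol Ω) := rfl

/-- Fubini and the substitution x ↦ x + y. This identifies the pointwise convolution with the one
defined by duality. -/
theorem integral_convFun_mul {Ω S : BoundedOpen d} (h : LpOn 2 (Ω.sub S)) (g : LpOn 2 S)
    (φ : Cc Ω) :
    ∫ x in Ω.carrier, convFun h g x * φ.1 x = h.toRadon (pairing φ g) := by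
  obtain ⟨C, hC⟩ := Cc.exists_bound φ
  have hφ : Continuous φ.1 := φ.2.1
  set H := (Ω.sub S).carrier.indicator h with hH
  set G := S.carrier.indicator g with hG
  -- L² functions on bounded sets are integrable, so the convolution integrand is integrable on the
  -- product; the bounded factor φ does no harm.
  have hint : Integrable (fun p : EuclideanSpace ℝ (Fin d) × EuclideanSpace ℝ (Fin d) =>
      H p.2 * G (p.1 - p.2) * φ.1 p.1) (volume.prod volume) := by
    have := (integrable_indicator h).convolution_integrand (ContinuousLinearMap.mul ℝ ℝ)
      (integrable_indicator g)
    exact this.mul_bdd (c := C) (hφ.comp continuous_fst).aestronglyMeasurable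
      (ae_of_all _ fun p => hC _)
  have hinner : ∀ y, ∫ x, G (x - y) * φ.1 x = ∫ x in S.carrier, φ.1 (x + y) * g x := by
    intro y
    rw [← integral_indicator S.isOpen.measurableSet,
      ← integral_add_right_eq_self (fun x => G (x - y) * φ.1 x) y]
    congr 1; ext x
    by_cases hx : x ∈ S.carrier <;> simp [hG, hx, mul_comm]
  rw [toRadon_apply]
  calc ∫ x in Ω.carrier, convFun h g x * φ.1 x
      = ∫ x, convFun h g x * φ.1 x :=
        setIntegral_eq_integral_of_forall_compl_eq_zero fun x hx => by simp [Cc.eq_zero φ hx]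
    _ = ∫ x, ∫ y, H y * G (x - y) * φ.1 x := by
        congr 1; ext x
        exact (integral_mul_const _ _).symm
    _ = ∫ y, ∫ x, H y * G (x - y) * φ.1 x := integral_integral_swap hint
    _ = ∫ y, H y * ∫ x in S.carrier, φ.1 (x + y) * g x := by
        congr 1; ext y
        rw [← hinner, ← integral_const_mul]
        simp only [mul_assoc]
    _ = ∫ y in (Ω.sub S).carrier, h y * ∫ x in S.carrier, φ.1 (x + y) * g x := by
        rw [← integral_indicator (Ω.sub S).isOpen.measurableSet]
        congr 1; ext y
        by_cases hy : y ∈ (Ω.sub S).carrier <;> simp [hH, hy]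
    _ = _ := (integral_subtype_comap (Ω.sub S).isOpen.measurableSet
        (fun y => h y * ∫ x in S.carrier, φ.1 (x + y) * g x)).symm

/-! ### Continuity of functions generated by square integrable latent variables -/

theorem memLp_of_continuous (Ω : BoundedOpen d) (q : ℝ≥0∞) {f : EuclideanSpace ℝ (Fin d) → ℝ}
    (hf : Continuous f) : MemLp f q (volume.restrict Ω.carrier) := by
  obtain ⟨C, hC⟩ := Ω.isBounded.isCompact_closure.exists_bound_of_continuousOn hf.continuousOn
  refine MemLp.of_bound hf.aestronglyMeasurable C ?_
  filter_upwards [ae_restrict_mem Ω.isOpen.measurableSet] with x hx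
  exact hC x (subset_closure hx)

theorem MemCClosure.zero {Ω : BoundedOpen d} {q : ℝ≥0∞} : MemCClosure (0 : LpOn q Ω) :=
  ⟨0, continuousOn_const, Lp.coeFn_zero _ _ _⟩

theorem MemCClosure.add {Ω : BoundedOpen d} {q : ℝ≥0∞} {v w : LpOn q Ω}
    (hv : MemCClosure v) (hw : MemCClosure w) : MemCClosure (v + w) := by
  obtain ⟨f, hf, hvf⟩ := hv
  obtain ⟨g, hg, hwg⟩ := hw
  exact ⟨f + g, hf.add hg, (Lp.coeFn_add v w).trans (hvf.add hwg)⟩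

theorem MemCClosure.sum {Ω : BoundedOpen d} {q : ℝ≥0∞} {ι : Type*} (s : Finset ι)
    (v : ι → LpOn q Ω) (hv : ∀ i ∈ s, MemCClosure (v i)) : MemCClosure (∑ i ∈ s, v i) :=
  Finset.sum_induction v MemCClosure (fun _ _ => MemCClosure.add) MemCClosure.zero hv

/-- The continuous function `convFun h g` satisfies the defining property of the convolution, so
uniqueness makes it a representative. -/
theorem memCClosure_conv_toRadon {Ω S : BoundedOpen d} {q : ℝ≥0∞} [Fact (1 ≤ q)] (hq : q ≤ 2)
    (h : LpOn 2 (Ω.sub S)) (g : LpOn 2 S) : MemCClosure (conv q h.toRadon g) := by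
  have hm := memLp_of_continuous Ω q (continuous_convFun h g)
  have hw : IsConv h.toRadon g (hm.toLp _) := fun φ => by
    rw [← integral_convFun_mul]
    refine integral_congr_ae ?_
    filter_upwards [hm.coeFn_toLp] with x hx
    rw [hx]
  rw [(existsUnique_isConv hq h.toRadon g).unique (isConv_conv hq h.toRadon g) hw]
  exact ⟨convFun h g, (continuous_convFun h g).continuousOn, hm.coeFn_toLp⟩

/-! ### Finiteness of the cost makes the first latent variables square integrable -/

theorem ae_vol_of_ae_restrict {Ω : BoundedOpen d} {P : EuclideanSpace ℝ (Fin d) → Prop}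
    (h : ∀ᵐ x ∂(volume.restrict Ω.carrier), P x) : ∀ᵐ x : Ω.carrier ∂(vol Ω), P x := by
  rw [← map_comap_subtype_coe Ω.isOpen.measurableSet] at h
  exact ae_of_ae_map measurable_subtype_coe.aemeasurable h

/-- The exponents may differ: the prior embeds convolutions as Lᵠ functions, whereas the assumption
on the penalties supplies L² functions. -/
theorem toRadon_congr {Ω : BoundedOpen d} {p q : ℝ≥0∞} [Fact (1 ≤ p)] [Fact (1 ≤ q)]
    {f : LpOn p Ω} {g : LpOn q Ω} (h : f =ᵐ[volume.restrict Ω.carrier] g) :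
    f.toRadon = g.toRadon := by
  ext φ
  rw [toRadon_apply, toRadon_apply]
  refine integral_congr_ae ?_
  filter_upwards [ae_vol_of_ae_restrict h] with x hx
  rw [hx]

theorem toRadon_add {Ω : BoundedOpen d} {q : ℝ≥0∞} [Fact (1 ≤ q)] (f g : LpOn q Ω) :
    (f + g).toRadon = f.toRadon + g.toRadon := by
  ext φ
  rw [_root_.add_apply, toRadon_apply, toRadon_apply, toRadon_apply,
    ← integral_add (LpOn.integrable_mul f φ) (LpOn.integrable_mul g φ)]
  refine integral_congr_ae ?_
  filter_upwards [ae_vol_of_ae_restrict (Lp.coeFn_add f g)] with x hx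
  rw [hx, Pi.add_apply, add_mul]

/-- A convolution is square integrable, whatever the exponent it is considered with. -/
theorem exists_conv_eq_incl {Ω S : BoundedOpen d} {q : ℝ≥0∞} [Fact (1 ≤ q)] (hq : q ≤ 2)
    (μ : Radon (Ω.sub S)) (g : LpOn 2 S) : ∃ w : LpOn 2 Ω, conv q μ g = LpOn.incl hq w := by
  obtain ⟨w, hw⟩ := exists_isConv μ g
  exact ⟨w, (existsUnique_isConv hq μ g).unique (isConv_conv hq μ g) hw⟩

theorem incl_zero {Ω : BoundedOpen d} {p q : ℝ≥0∞} (h : p ≤ q) :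
    LpOn.incl h (0 : LpOn q Ω) = 0 := rfl

theorem incl_add {Ω : BoundedOpen d} {p q : ℝ≥0∞} (h : p ≤ q) (f g : LpOn q Ω) :
    LpOn.incl h (f + g) = LpOn.incl h f + LpOn.incl h g := rfl

theorem eq_toRadon_add_of_sub_eq {Ω : BoundedOpen d} {q : ℝ≥0∞} [Fact (1 ≤ q)] (hq : q ≤ 2)
    {μ : Radon Ω} {f w : LpOn 2 Ω} (h : μ - (LpOn.incl hq w).toRadon = f.toRadon) :
    μ = (f + w).toRadon := by
  rw [toRadon_add, ← h, toRadon_congr (g := w) (Filter.EventuallyEq.refl _ _)]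
  ext φ
  exact (sub_add_cancel (μ φ) (w.toRadon φ)).symm

theorem exists_layerConv_eq_incl {q : ℝ≥0∞} [Fact (1 ≤ q)] (hq : q ≤ 2) {net : Network}
    {Ω S : BoundedOpen d} (l : Fin net.L) (μ : LayerVar net Ω S (l + 1))
    (θ : ↥(net.edges l) → LpOn 2 S) (k : Fin (net.N l)) :
    ∃ w : LpOn 2 (layerDomain Ω S l), layerConv q l μ θ k = LpOn.incl hq w := by
  refine Finset.sum_induction _ (fun v => ∃ w : LpOn 2 (layerDomain Ω S l), v = LpOn.incl hq w)
    ?_ ⟨0, (incl_zero hq).symm⟩ ?_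
  · rintro _ _ ⟨w, rfl⟩ ⟨w', rfl⟩
    exact ⟨w + w', (incl_add hq w w').symm⟩
  · intro e _
    split_ifs
    · exact exists_conv_eq_incl hq _ _
    · exact ⟨0, (incl_zero hq).symm⟩

theorem memCClosure_layerConv_zero {q : ℝ≥0∞} [Fact (1 ≤ q)] (hq : q ≤ 2) {net : Network}
    {Ω S : BoundedOpen d} (μ : LayerVar net Ω S 1)
    (hμ : ∀ n, ∃ f : LpOn 2 (layerDomain Ω S 1), μ n = f.toRadon)
    (θ : ↥(net.edges ⟨0, net.L_pos⟩) → LpOn 2 S) (k : Fin (net.N 0)) :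
    MemCClosure (layerConv q (Ω := Ω) ⟨0, net.L_pos⟩ μ θ k) := by
  refine MemCClosure.sum _ _ fun e _ => ?_
  split_ifs
  · obtain ⟨f, hf⟩ := hμ e.1.1
    rw [hf]
    exact memCClosure_conv_toRadon (Ω := Ω) (S := S) hq f (θ e)
  · exact MemCClosure.zero

/-- A function of finite generative prior is continuous up to the boundary. -/
theorem memCClosure_of_genPrior_lt_top {q : ℝ≥0∞} [Fact (1 ≤ q)] (hq : q ≤ 2) {net : Network}
    (hL : 2 ≤ net.L) {Ω S : BoundedOpen d} {c : ℕ}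
    {J : (l : ℕ) → LayerVar net Ω S l → ℝ≥0∞}
    (hJ : ∀ μ : LayerVar net Ω S 1, J 1 μ < ⊤ →
      ∀ n, ∃ f : LpOn 2 (layerDomain Ω S 1), μ n = f.toRadon)
    {Z : Kernels net S →L[ℝ] EuclideanSpace ℝ (Fin c)} {v : LpOn q Ω}
    (hv : genPrior J Z v < ⊤) : MemCClosure v := by
  -- Some feasible pair of finite cost suffices; the infimum need not be attained.
  simp only [genPrior, iInf_lt_iff] at hv
  obtain ⟨μ, θ, ⟨rfl, -, -⟩, hcost⟩ := hv
  refine memCClosure_layerConv_zero hq _ (fun n => ?_) _ _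
  have h1 := (ENNReal.add_lt_top.1 hcost).2
  -- With indices starting at 0, this summand is the penalty on μ¹ - μ² * θ². It is present because
  -- there are at least two layers.
  have h2 := ENNReal.sum_lt_top.1 h1 ⟨0, net.L_pos⟩ (Finset.mem_univ _)
  have h3 : (0 : ℕ) + 1 < net.L := hL
  rw [dif_pos h3] at h2
  obtain ⟨f, hf⟩ := hJ _ h2 n
  obtain ⟨w, hw⟩ := exists_layerConv_eq_incl hq (⟨0 + 1, h3⟩ : Fin net.L) (μ ⟨0 + 1, h3⟩)
    (θ ⟨0 + 1, h3⟩) n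
  have hf' : μ ⟨0, net.L_pos⟩ n - (layerConv q (⟨0 + 1, h3⟩ : Fin net.L) (μ ⟨0 + 1, h3⟩)
      (θ ⟨0 + 1, h3⟩) n).toRadon = f.toRadon := hf
  rw [hw] at hf'
  exact ⟨f + w, eq_toRadon_add_of_sub_eq (Ω := layerDomain Ω S 1) hq hf'⟩

/-! ### Functions with finite energy of linear growth have bounded variation -/

/-- On a large sphere of radius r, `j` exceeds its value at 0 by at least 1, and convexity along
rays propagates this growth outwards. Inside the ball the left side is nonpositive. -/
theorem IsLinearGrowthIntegrand.exists_norm_div_sub_one_le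
    {j : EuclideanSpace ℝ (Fin d) → ℝ} (hj : IsLinearGrowthIntegrand j) :
    ∃ r > 0, ∀ ξ, ‖ξ‖ / r - 1 ≤ j ξ := by
  have h1 := hj.coercive.eventually_ge_atTop (j 0 + 1)
  rw [Filter.Eventually, ← comap_norm_atTop, mem_comap] at h1
  obtain ⟨t, ht, hsub⟩ := h1
  obtain ⟨R, hR⟩ := mem_atTop_sets.1 ht
  refine ⟨max R 1, by positivity, fun ξ => ?_⟩
  have hr : (0 : ℝ) < max R 1 := by positivity
  rcases le_total ‖ξ‖ (max R 1) with h | h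
  · have : ‖ξ‖ / max R 1 ≤ 1 := (div_le_one hr).2 h
    linarith [hj.nonneg ξ]
  · have hξ : 0 < ‖ξ‖ := hr.trans_le h
    set s := max R 1 / ‖ξ‖ with hs
    have hs0 : 0 < s := div_pos hr hξ
    have hs1 : s ≤ 1 := (div_le_one hξ).2 h
    have hn : ‖s • ξ‖ = max R 1 := by
      rw [norm_smul, Real.norm_of_nonneg hs0.le, hs, div_mul_cancel₀ _ hξ.ne']
    have h2 : j 0 + 1 ≤ j (s • ξ) := by
      apply hsub
      apply hR
      rw [hn]
      exact le_max_left _ _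
    -- Convexity between 0 and ξ, at the point s • ξ of the sphere.
    have h3 := hj.convex.2 (mem_univ (0 : EuclideanSpace ℝ (Fin d))) (mem_univ ξ)
      (sub_nonneg.2 hs1) hs0.le (by ring)
    rw [smul_zero, zero_add, smul_eq_mul, smul_eq_mul] at h3
    have h4 : 1 ≤ s * j ξ := by nlinarith [hj.nonneg 0]
    have h5 : ‖ξ‖ / max R 1 = s⁻¹ := by rw [hs, inv_div]
    rw [h5]
    have h6 : s⁻¹ ≤ j ξ := by
      rw [inv_le_iff_one_le_mul₀' hs0]
      exact h4
    linarith

theorem IsTVField.continuous_divergence {Ω : BoundedOpen d}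
    {φ : EuclideanSpace ℝ (Fin d) → EuclideanSpace ℝ (Fin d)} (hφ : IsTVField Ω φ) :
    Continuous (divergence φ) := by
  have h := hφ.1.continuous_fderiv (by simp)
  unfold divergence
  fun_prop

theorem IsTVField.exists_bound_divergence {Ω : BoundedOpen d}
    {φ : EuclideanSpace ℝ (Fin d) → EuclideanSpace ℝ (Fin d)} (hφ : IsTVField Ω φ) :
    ∃ C, ∀ x, ‖divergence φ x‖ ≤ C := by
  refine hφ.continuous_divergence.bounded_above_of_compact_support ?_
  refine (hφ.2.1.fderiv (𝕜 := ℝ)).mono fun x hx => ?_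
  contrapose! hx
  simp only [Function.mem_support, not_not] at hx
  simp [divergence, hx]

theorem integrable_coe {Ω : BoundedOpen d} {q : ℝ≥0∞} [hq : Fact (1 ≤ q)] (w : LpOn q Ω) :
    Integrable w (volume.restrict Ω.carrier) :=
  (Lp.memLp w).integrable hq.out

theorem IsTVField.integrable_mul_divergence {Ω : BoundedOpen d}
    {φ : EuclideanSpace ℝ (Fin d) → EuclideanSpace ℝ (Fin d)} (hφ : IsTVField Ω φ)
    {w : EuclideanSpace ℝ (Fin d) → ℝ} (hw : IntegrableOn w Ω.carrier) :
    IntegrableOn (fun x => w x * divergence φ x) Ω.carrier := by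
  obtain ⟨C, hC⟩ := hφ.exists_bound_divergence
  exact Integrable.mul_bdd (c := C) hw hφ.continuous_divergence.aestronglyMeasurable
    (ae_of_all _ hC)

/-- The functional `w ↦ ∫_Ω w div φ` on `L^1(Ω)`. -/
theorem IsTVField.exists_dual {Ω : BoundedOpen d}
    {φ : EuclideanSpace ℝ (Fin d) → EuclideanSpace ℝ (Fin d)} (hφ : IsTVField Ω φ) :
    ∃ p : StrongDual ℝ (LpOn 1 Ω), ∀ w : LpOn 1 Ω,
      p w = ∫ x in Ω.carrier, w x * divergence φ x := by
  obtain ⟨C, hC⟩ := hφ.exists_bound_divergence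
  refine ⟨LinearMap.mkContinuous
    { toFun := fun w : LpOn 1 Ω => ∫ x in Ω.carrier, w x * divergence φ x
      map_add' := fun v w => ?_
      map_smul' := fun c w => ?_ } C fun w => ?_, fun w => rfl⟩
  · rw [← integral_add (hφ.integrable_mul_divergence (integrable_coe v))
      (hφ.integrable_mul_divergence (integrable_coe w))]
    refine integral_congr_ae ?_
    filter_upwards [Lp.coeFn_add v w] with x hx
    rw [hx, Pi.add_apply, add_mul]
  · rw [RingHom.id_apply, smul_eq_mul, ← integral_const_mul]
    refine integral_congr_ae ?_
    filter_upwards [Lp.coeFn_smul c w] with x hx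
    rw [hx, Pi.smul_apply, smul_eq_mul, mul_assoc]
  · change ‖∫ x in Ω.carrier, w x * divergence φ x‖ ≤ C * ‖w‖
    rw [L1.norm_eq_integral_norm, ← integral_const_mul]
    refine norm_integral_le_of_norm_le ((integrable_coe w).norm.const_mul C) (ae_of_all _ fun x => ?_)
    rw [norm_mul, mul_comm]
    exact mul_le_mul_of_nonneg_right (hC x) (norm_nonneg _)

/-- Each component of φ is an admissible scalar test function; sum the weak derivative identities.
-/
theorem IsWeakGradient.integral_mul_divergence {Ω : BoundedOpen d}
    {w : EuclideanSpace ℝ (Fin d) → ℝ} {g : EuclideanSpace ℝ (Fin d) → EuclideanSpace ℝ (Fin d)}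
    (hw : IntegrableOn w Ω.carrier) (hg : IsWeakGradient Ω w g)
    {φ : EuclideanSpace ℝ (Fin d) → EuclideanSpace ℝ (Fin d)} (hφ : IsTVField Ω φ) :
    ∫ x in Ω.carrier, w x * divergence φ x = -∫ x in Ω.carrier, inner ℝ (φ x) (g x) := by
  obtain ⟨h1, h2, h3, h4⟩ := hφ
  have hdiff : Differentiable ℝ φ := h1.differentiable (by simp)
  have hcomp : ∀ i, ContDiff ℝ ∞ fun x => φ x i := contDiff_euclidean.1 h1
  have hzero : ∀ i, Function.support (fun x => φ x i) ⊆ Function.support φ := fun i x hx => by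
    contrapose! hx
    simp only [Function.mem_support, not_not] at hx
    simp [hx]
  have hsupp : ∀ i, HasCompactSupport fun x => φ x i := fun i =>
    h2.mono (hzero i)
  have hderiv : ∀ i x v, fderiv ℝ (fun x => φ x i) x v = fderiv ℝ φ x v i := fun i x v => by
    have := ((EuclideanSpace.proj i : EuclideanSpace ℝ (Fin d) →L[ℝ] ℝ).hasFDerivAt.comp x
      (hdiff x).hasFDerivAt).fderiv
    exact congrArg (fun L => L v) this
  have hcd : ∀ i, Continuous fun x => fderiv ℝ (fun x => φ x i) x (EuclideanSpace.single i 1) :=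
    fun i => ((hcomp i).continuous_fderiv (by simp)).clm_apply continuous_const
  have hgi : ∀ i, IntegrableOn (fun x => g x i) Ω.carrier := fun i =>
    (EuclideanSpace.proj i : EuclideanSpace ℝ (Fin d) →L[ℝ] ℝ).integrable_comp hg.1
  calc ∫ x in Ω.carrier, w x * divergence φ x
      = ∫ x in Ω.carrier, ∑ i, w x * fderiv ℝ (fun x => φ x i) x (EuclideanSpace.single i 1) := by
        simp only [divergence, Finset.mul_sum, hderiv]
    _ = ∑ i, ∫ x in Ω.carrier, w x * fderiv ℝ (fun x => φ x i) x (EuclideanSpace.single i 1) := by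
        refine integral_finsetSum _ fun i _ => ?_
        obtain ⟨C, hC⟩ := (hcd i).bounded_above_of_compact_support
          ((hsupp i).fderiv_apply (𝕜 := ℝ) _)
        exact Integrable.mul_bdd (c := C) hw (hcd i).aestronglyMeasurable (ae_of_all _ hC)
    _ = ∑ i, -∫ x in Ω.carrier, g x i * φ x i := Finset.sum_congr rfl fun i _ =>
        hg.2 _ (hcomp i) (hsupp i) ((closure_mono (hzero i)).trans h3) i
    _ = -∫ x in Ω.carrier, ∑ i, g x i * φ x i := by
        rw [Finset.sum_neg_distrib, integral_finsetSum]
        intro i _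
        refine Integrable.mul_bdd (c := 1) (hgi i) (hcomp i).continuous.aestronglyMeasurable
          (ae_of_all _ fun x => (PiLp.norm_apply_le (φ x) i).trans (h4 x))
    _ = _ := by
        simp [PiLp.inner_apply]

/-- Since |φ| ≤ 1, the integral is at most that of |∇w|. The volume comes from integrating the 1 in
|ξ|/r ≤ j(ξ) + 1. -/
theorem ofReal_integral_mul_divergence_le_gradEnergy {Ω : BoundedOpen d}
    {j : EuclideanSpace ℝ (Fin d) → ℝ} (hj : IsLinearGrowthIntegrand j) {r : ℝ} (hr : 0 < r)
    (hjr : ∀ ξ, ‖ξ‖ / r - 1 ≤ j ξ)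
    {φ : EuclideanSpace ℝ (Fin d) → EuclideanSpace ℝ (Fin d)} (hφ : IsTVField Ω φ)
    (w : LpOn 1 Ω) :
    ENNReal.ofReal (r⁻¹ * ∫ x in Ω.carrier, w x * divergence φ x) ≤
      gradEnergy Ω j w + volume Ω.carrier := by
  unfold gradEnergy
  split_ifs with h
  -- Only the defining property of the chosen weak gradient matters, so its uniqueness is not
  -- needed.
  · have hg := h.choose_spec
    set g := h.choose
    have hle : r⁻¹ * ∫ x in Ω.carrier, w x * divergence φ x ≤ ∫ x in Ω.carrier, ‖g x‖ / r := by
      rw [hg.integral_mul_divergence (integrable_coe w) hφ, integral_div, inv_mul_eq_div]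
      refine div_le_div_of_nonneg_right ?_ hr.le
      refine (neg_le_abs _).trans ?_
      rw [← Real.norm_eq_abs]
      refine norm_integral_le_of_norm_le hg.1.norm (ae_of_all _ fun x => ?_)
      refine (norm_inner_le_norm _ _).trans ?_
      exact mul_le_of_le_one_left (norm_nonneg _) (hφ.2.2.2 x)
    refine (ENNReal.ofReal_le_ofReal hle).trans ?_
    rw [ofReal_integral_eq_lintegral_ofReal (hg.1.norm.div_const r)
      (ae_of_all _ fun x => by positivity)]
    calc ∫⁻ x in Ω.carrier, ENNReal.ofReal (‖g x‖ / r)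
        ≤ ∫⁻ x in Ω.carrier, (ENNReal.ofReal (j (g x)) + 1) := by
          refine lintegral_mono fun x => ?_
          rw [← ENNReal.ofReal_one, ← ENNReal.ofReal_add (hj.nonneg _) zero_le_one]
          exact ENNReal.ofReal_le_ofReal (by linarith [hjr (g x)])
      _ = _ := by
          rw [lintegral_add_right _ measurable_const]
          simp
  · simp

/-- The factor r⁻¹ matches the slope of the lower bound on `j`, which keeps the conjugate finite,
with a bound independent of φ. -/
theorem conjugate_gradEnergy_le {Ω : BoundedOpen d}
    {j : EuclideanSpace ℝ (Fin d) → ℝ} (hj : IsLinearGrowthIntegrand j) {r : ℝ} (hr : 0 < r)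
    (hjr : ∀ ξ, ‖ξ‖ / r - 1 ≤ j ξ)
    {φ : EuclideanSpace ℝ (Fin d) → EuclideanSpace ℝ (Fin d)} (hφ : IsTVField Ω φ)
    {p : StrongDual ℝ (LpOn 1 Ω)}
    (hp : ∀ w : LpOn 1 Ω, p w = ∫ x in Ω.carrier, w x * divergence φ x) :
    conjugate (fun w : LpOn 1 Ω => (gradEnergy Ω j w : EReal)) (r⁻¹ • p) ≤
      (volume Ω.carrier : EReal) := by
  refine iSup_le fun w => ?_
  have h := ofReal_integral_mul_divergence_le_gradEnergy hj hr hjr hφ w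
  have hle : (((r⁻¹ • p) w : ℝ) : EReal) ≤ (volume Ω.carrier : EReal) + gradEnergy Ω j w := by
    rw [_root_.smul_apply, smul_eq_mul, hp, add_comm, ← EReal.coe_ennreal_add]
    refine le_trans ?_ (EReal.coe_ennreal_le_coe_ennreal_iff.2 h)
    rw [EReal.coe_ennreal_ofReal]
    exact EReal.coe_le_coe_iff.2 (le_max_left _ _)
  exact EReal.sub_le_of_le_add hle

theorem TV_lt_top_of_linearGrowthReg_lt_top {Ω : BoundedOpen d} {q : ℝ≥0∞} [Fact (1 ≤ q)]
    {j : EuclideanSpace ℝ (Fin d) → ℝ} (hj : IsLinearGrowthIntegrand j) {w : LpOn q Ω}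
    (hw : linearGrowthReg Ω j w < ⊤) : TV Ω w < ⊤ := by
  obtain ⟨r, hr, hjr⟩ := hj.exists_norm_div_sub_one_le
  set w' : LpOn 1 Ω := LpOn.incl Fact.out w
  set B := biconjugate (fun w' : LpOn 1 Ω => (gradEnergy Ω j w' : EReal)) w' with hB
  have hB0 : 0 ≤ B := biconjugate_nonneg (fun _ => EReal.coe_ennreal_nonneg _) w'
  have hBtop : B ≠ ⊤ := EReal.toENNReal_ne_top_iff.1 hw.ne
  have hvol : volume Ω.carrier ≠ ⊤ := Ω.isBounded.measure_lt_top.ne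
  -- This bound, uniform in φ, results from solving r⁻¹ ∫ w div φ - |Ω| ≤ J**(w) for the integral.
  refine lt_of_le_of_lt (b := ENNReal.ofReal (r * (B.toReal + (volume Ω.carrier).toReal)))
    (iSup₂_le fun φ hφ => ENNReal.ofReal_le_ofReal ?_) ENNReal.ofReal_lt_top
  obtain ⟨p, hp⟩ := hφ.exists_dual
  have h1 : (((r⁻¹ • p) w' : ℝ) : EReal) -
      conjugate (fun w : LpOn 1 Ω => (gradEnergy Ω j w : EReal)) (r⁻¹ • p) ≤ B :=
    le_iSup (fun p : StrongDual ℝ (LpOn 1 Ω) => ((p w' : ℝ) : EReal) -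
      conjugate (fun w : LpOn 1 Ω => (gradEnergy Ω j w : EReal)) p) (r⁻¹ • p)
  have h2 := (EReal.sub_le_sub le_rfl (conjugate_gradEnergy_le hj hr hjr hφ hp)).trans h1
  -- All terms are finite (`hB0` excludes ⊥), so the inequality can be rearranged in ℝ.
  rw [← EReal.coe_toReal hBtop (ne_bot_of_le_ne_bot (by simp) hB0), ← ENNReal.ofReal_toReal hvol,
    EReal.coe_ennreal_ofReal, max_eq_left ENNReal.toReal_nonneg, ← EReal.coe_sub,
    EReal.coe_le_coe_iff, _root_.smul_apply, smul_eq_mul, hp, sub_le_iff_le_add,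
    inv_mul_le_iff₀ hr] at h2
  exact h2

theorem memBV_of_TV_lt_top {Ω : BoundedOpen d} {q : ℝ≥0∞} [Fact (1 ≤ q)] {w : LpOn q Ω}
    (hw : TV Ω w < ⊤) : MemBV Ω w :=
  ⟨integrable_coe w, hw⟩

/-! ### Positive weights and conclusion for minimizers -/

theorem weightR_pos {ν : ℝ} (hν : ν ∈ Set.Ioo (0 : ℝ) 1) : 0 < weightR ν :=
  div_pos hν.1 (lt_min hν.1 (sub_pos.2 hν.2))

theorem weightG_pos {ν : ℝ} (hν : ν ∈ Set.Ioo (0 : ℝ) 1) : 0 < weightG ν :=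
  div_pos (sub_pos.2 hν.2) (lt_min hν.1 (sub_pos.2 hν.2))

theorem lt_top_of_ofReal_mul_lt_top {a : ℝ} (ha : 0 < a) {x : ℝ≥0∞}
    (h : ENNReal.ofReal a * x < ⊤) : x < ⊤ :=
  ENNReal.lt_top_of_mul_ne_top_right h.ne (ENNReal.ofReal_pos.2 ha).ne'

end GenPrior

end

open GenPrior in
theorem mainTheorem8 {d : ℕ} (Ω S : BoundedOpen d) (q : ℝ≥0∞) [Fact (1 ≤ q)]
    (hq1 : 1 < q) (hq2 : q ≤ 2)
    {Y : Type*} [NormedAddCommGroup Y] [NormedSpace ℝ Y] [CompleteSpace Y]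
    (y : Y) (D : Y → Y → ℝ≥0∞) (A : LpOn q Ω → Y)
    (lam ν : ℝ) (hlam : 0 < lam) (hν : ν ∈ Set.Ioo (0 : ℝ) 1)
    (net : Network) (hL : 2 ≤ net.L)
    (J : (l : ℕ) → LayerVar net Ω S l → ℝ≥0∞)
    (hJ : ∀ l, 1 ≤ l → l < net.L → ∀ μ : LayerVar net Ω S l, J l μ < ⊤ →
      ∀ n, ∃ f : LpOn 2 (layerDomain Ω S l), μ n = f.toRadon)
    {c : ℕ} (Z : Kernels net S →L[ℝ] EuclideanSpace ℝ (Fin c))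
    (R : LpOn q Ω → ℝ≥0∞)
    (hR : (R = fun w : LpOn q Ω => TV Ω (w : EuclideanSpace ℝ (Fin d) → ℝ)) ∨
      ∃ j : EuclideanSpace ℝ (Fin d) → ℝ, IsLinearGrowthIntegrand j ∧ R = linearGrowthReg Ω j)
    (hfin : ∃ u v : LpOn q Ω, energy lam ν (D y) A R (genPrior J Z) u v < ⊤)
    (u v : LpOn q Ω)
    (hmin : ∀ u' v' : LpOn q Ω, energy lam ν (D y) A R (genPrior J Z) u v ≤
      energy lam ν (D y) A R (genPrior J Z) u' v') :
    u = (u - v) + v ∧ MemBV Ω (u - v : LpOn q Ω) ∧ MemCClosure v := by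
  -- Minimality enters only through finiteness of the energy at (u, v).
  have hE : energy lam ν (D y) A R (genPrior J Z) u v < ⊤ := by
    obtain ⟨u', v', h⟩ := hfin
    exact (hmin u' v').trans_lt h
  obtain ⟨hE1, hE2⟩ := ENNReal.add_lt_top.1 hE
  have hRuv : R (u - v) < ⊤ :=
    lt_top_of_ofReal_mul_lt_top (weightR_pos hν) (ENNReal.add_lt_top.1 hE1).2
  have hGv : genPrior J Z v < ⊤ := lt_top_of_ofReal_mul_lt_top (weightG_pos hν) hE2
  refine ⟨(sub_add_cancel u v).symm, memBV_of_TV_lt_top ?_,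
    memCClosure_of_genPrior_lt_top hq2 hL (hJ 1 le_rfl hL) hGv⟩
  rcases hR with rfl | ⟨j, hj, rfl⟩
  · exact hRuv
  · exact TV_lt_top_of_linearGrowthReg_lt_top hj hRuv
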